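/- The random Menger sponge $\mathcal{M}_p$, for $p\in[0,1]$, is defined as follows. Let $D=\{0,1,2\}^3\setminus\{(1,1,0),(1,0,1),(0,1,1),(1,1,2),(1,2,1),(2,1,1),(1,1,1)\}$ (so $\#D=20$) and $f_d(x)=\frac13x+\frac13d$ for $d\in D$, $x\in\mathbb{R}^3$. Consider the tree of finite words over $D$, and let all edges (from a word $\mathbf{i}$ to its child $\mathbf{i}k$, $k\in D$) be independently open with probability $p$ and closed with probability $1-p$. Let $X_n\subset D^n$ be the random set of the words of length $n$ such that all edges on the path from the root (the empty word) to it are open, and put $$\mathcal{M}_p=\bigcap_{n=1}^{\infty}\ \bigcup_{(i_1,\dots,i_n)\in X_n} f_{i_1}\circ\cdots\circ f_{i_n}\big([0,1]^3\big).$$ Non-extinction is the event that there is an infinite word over $D$ all of whose initial segments of length $n$ belong to $X_n$, for every $n$. Let $\mathrm{proj}_{(1,1,1)}(x,y,z)=x+y+z$. **Theorem.** If $p>(8\cdot 6\cdot 6)^{-1/3}=0.1514\dots$ (and $p\le 1$), then non-extinction has positive probability and, almost surely conditioned on non-extinction, $\mathrm{proj}_{(1,1,1)}(\mathcal{M}_p)\subset\mathbb{R}$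 has positive one-dimensional Lebesgue measure. -/

import Mathlib

namespace MengerPercolation

open MeasureTheory ProbabilityTheory

section CoinTossing

variable {ι E : Type*}

/-- The sample space: to every node `w` of the tree of finite words over `ι` (a word is written from
the root downwards) a result of the coin tosses deciding which of its children `w ++ [k]`, `k : ι`,
are kept. -/
abbrev Sample (ι : Type*) : Type _ := List ι → ι → Bool

/-- The law of the coin tosses: all of them are independent, and each shows `true` (head) with
probability `p`. -/
noncomputable def coinLaw (ι : Type*) [Fintype ι] (p : unitInterval) : Measure (Sample ι) :=
  Measure.infinitePi fun _ : List ι => Measure.pi fun _ : ι => bernoulliMeasure true false p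

instance coinLaw_isProbabilityMeasure (ι : Type*) [Fintype ι] (p : unitInterval) :
    IsProbabilityMeasure (coinLaw ι p) := by
  unfold coinLaw
  infer_instance

/-- The random set of retained words of length `n`: the root is retained, and `w ++ [k]` is
retained if `w` is retained and the toss for the child `k` of `w` shows head. -/
def retained (ω : Sample ι) : ℕ → Set (List ι)
  | 0 => {[]}
  | n + 1 => {v | ∃ w ∈ retained ω n, ∃ k : ι, ω w k = true ∧ v = w ++ [k]}

/-- The event of non-extinction: some infinite path is retained, that is, all of its finite
initial segments are. -/
def nonExtinction (ι : Type*) : Set (Sample ι) :=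
  {ω | ∃ σ : ℕ → ι, ∀ n : ℕ, (List.ofFn fun j : Fin n => σ j) ∈ retained ω n}

/-- The composition `f_{i₁} ∘ ⋯ ∘ f_{iₙ}` along the word `[i₁, …, iₙ]`. -/
def wordMap (f : ι → E → E) : List ι → E → E
  | [] => id
  | i :: w => f i ∘ wordMap f w

/-- The coin tossing self-similar set of the iterated function system `f` for the outcome `ω`;
`B` is a (nonempty) compact set with `f i '' B ⊆ B` for all `i`, and the set does not depend on
which one. -/
def coinTossingSet (f : ι → E → E) (B : Set E) (ω : Sample ι) : Set E :=
  ⋂ n : ℕ, ⋃ w ∈ retained ω (n + 1), wordMap f w '' B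

end CoinTossing

/-- The seven subcubes that are removed in the construction of the Menger sponge: the six central
cubes of the faces and the central cube. -/
def removedDigits : Finset (Fin 3 → Fin 3) :=
  {![1, 1, 0], ![1, 0, 1], ![0, 1, 1], ![1, 1, 2], ![1, 2, 1], ![2, 1, 1], ![1, 1, 1]}

/-- The index set of the subcubes that are kept in the Menger sponge. -/
abbrev MengerIndex : Type := {d : Fin 3 → Fin 3 // d ∉ removedDigits}

theorem card_mengerIndex : Fintype.card MengerIndex = 20 := by decide

/-- The maps `x ↦ x / 3 + d / 3` of the iterated function system of the Menger sponge. -/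
noncomputable def mengerMap (d : MengerIndex) (x : EuclideanSpace ℝ (Fin 3)) :
    EuclideanSpace ℝ (Fin 3) :=
  (1 / 3 : ℝ) • x + WithLp.toLp 2 fun j => ((d.1 j : ℕ) : ℝ) / 3

/-- The unit cube `[0,1]³`. -/
def unitCube : Set (EuclideanSpace ℝ (Fin 3)) := {x | ∀ j, x j ∈ Set.Icc (0 : ℝ) 1}

theorem isCompact_unitCube : IsCompact unitCube := by
  have h : IsCompact (Set.pi Set.univ fun _ : Fin 3 => Set.Icc (0 : ℝ) 1) :=
    isCompact_univ_pi fun _ => isCompact_Icc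
  have h2 := h.image (PiLp.continuous_toLp 2 (fun _ : Fin 3 => ℝ))
  convert h2 using 1
  ext x
  constructor
  · intro hx
    exact ⟨x.ofLp, fun j _ => hx j, rfl⟩
  · rintro ⟨y, hy, rfl⟩ j
    exact hy j trivial

theorem mengerMap_image_unitCube (d : MengerIndex) : mengerMap d '' unitCube ⊆ unitCube := by
  rintro _ ⟨x, hx, rfl⟩ j
  have h0 : (0 : ℝ) ≤ ((d.1 j : ℕ) : ℝ) := Nat.cast_nonneg _
  have h2 : ((d.1 j : ℕ) : ℝ) ≤ 2 := by exact_mod_cast Nat.le_of_lt_succ (d.1 j).isLt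
  obtain ⟨ha, hb⟩ := hx j
  simp only [mengerMap, PiLp.add_apply, PiLp.smul_apply, smul_eq_mul, Set.mem_Icc]
  constructor <;> linarith

/-- The random Menger sponge, for the outcome `ω` of the coin tosses. -/
noncomputable def randomMengerSponge (ω : Sample MengerIndex) : Set (EuclideanSpace ℝ (Fin 3)) :=
  coinTossingSet mengerMap unitCube ω

/-- `proj_{(a,b,c)}(x,y,z) = a x + b y + c z`. -/
noncomputable def proj (a b c : ℝ) (x : EuclideanSpace ℝ (Fin 3)) : ℝ :=
  a * x 0 + b * x 1 + c * x 2

end MengerPercolation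

/-! The proof combines a zero-one dichotomy with a uniform lower bound for the mean length of the
projected approximations.

Dichotomy: extinction implies a null projection, and each of these events holds iff it holds in
every open subtree of the root. By independence both probabilities are fixed points of `q ↦ (1 - p +
p q) ^ 20`, which has at most one fixed point below `1`. So once a null projection is not almost
sure, the two events agree up to a null set (`positive_of_not_ae_null`).

Mean length: collect the covering probabilities at `t`, `1 + t`, `2 + t` into a vector. If `t = (a +
u) / 3`, independence of the children bounds the vector at `t` and generation `n + 1` below by `y /
(1 + y)` coordinatewise, where `y` is the mean matrix of the digit `a` applied to the vector at `u`
and generation `n`. For `θ ≤ 1` the power `-θ` turns this into an additive recursion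
(`rpow_neg_dotProduct_le`), so the integral over `t` of the `-θ`-th power is bounded by a sum of
averages over products of mean matrices. Column `a` of the matrix for the digit `a` sums to `8p`,
the other two columns to `6p`. By Jensen, averaging over `a` multiplies the `-θ`-th power of the
coordinate sum by at most `rate p θ`. Since `rate p 0 = 1` and the derivative there is `-log(8 * 6 *
6 * p ^ 3) / 3`, the threshold is exactly what makes `rate p θ < 1` for small `θ > 0`. The geometric
series bounds the negative moments uniformly in `n`, which keeps the mean length away from zero;
continuity from above passes this to the limit. -/

namespace MengerPercolation

open MeasureTheory ProbabilityTheory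

/-! ### Independence of the subtrees below the root -/

section Tree

variable {ι E : Type*}

/-- The coin tosses in the subtree below the child `k` of the root. -/
def shift (k : ι) (ω : Sample ι) : Sample ι := fun u => ω (k :: u)

/-- The outcome with root tosses `y.1` and subtrees `y.2`. -/
def graft (y : (ι → Bool) × (ι → Sample ι)) : Sample ι
  | [] => y.1
  | k :: u => y.2 k u

theorem shift_graft (y : (ι → Bool) × (ι → Sample ι)) (k : ι) : shift k (graft y) = y.2 k := rfl

theorem measurable_shift (k : ι) : Measurable (shift k) :=
  measurable_pi_lambda _ fun u => measurable_pi_apply (k :: u)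

theorem measurable_graft : Measurable (graft (ι := ι)) := by
  refine measurable_pi_lambda _ fun u => ?_
  cases u with
  | nil => exact measurable_fst
  | cons k u =>
    exact (measurable_pi_apply u).comp ((measurable_pi_apply k).comp measurable_snd)

theorem measurableSet_root (k : ι) : MeasurableSet {ω : Sample ι | ω [] k = true} := by
  have h : Measurable fun ω : Sample ι => ω [] k :=
    (measurable_pi_apply k).comp (measurable_pi_apply ([] : List ι))
  exact h (measurableSet_singleton true)

/-- `retained` grows words at their last letter, whereas the probabilistic recursions split off the
first one; this exchanges the two. -/
theorem mem_retained_succ (ω : Sample ι) (n : ℕ) (v : List ι) :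
    v ∈ retained ω (n + 1) ↔ ∃ k, ω [] k = true ∧ ∃ w ∈ retained (shift k ω) n, v = k :: w := by
  induction n generalizing v with
  | zero => simp [retained]
  | succ n ih =>
    constructor
    · rintro ⟨w, hw, k, hk, rfl⟩
      obtain ⟨k₀, h₀, w', hw', rfl⟩ := (ih w).1 hw
      exact ⟨k₀, h₀, w' ++ [k], ⟨w', hw', k, hk, rfl⟩, rfl⟩
    · rintro ⟨k₀, h₀, _, ⟨w', hw', k, hk, rfl⟩, rfl⟩
      exact ⟨k₀ :: w', (ih _).2 ⟨k₀, h₀, w', hw', rfl⟩, k, hk, rfl⟩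

theorem cons_mem_retained_succ (ω : Sample ι) (n : ℕ) (k : ι) (w : List ι) :
    k :: w ∈ retained ω (n + 1) ↔ ω [] k = true ∧ w ∈ retained (shift k ω) n := by
  rw [mem_retained_succ]
  constructor
  · rintro ⟨k', hk, w', hw, h⟩
    obtain ⟨rfl, rfl⟩ := List.cons.inj h
    exact ⟨hk, hw⟩
  · rintro ⟨hk, hw⟩
    exact ⟨k, hk, w, hw, rfl⟩

variable [Fintype ι] (p : unitInterval)

/-- Every word is empty or has a unique first letter, so the product over all words factors; it
suffices to compare the measures on boxes. -/
theorem map_graft_coinLaw :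
    ((Measure.pi fun _ : ι => bernoulliMeasure true false p).prod
      (Measure.pi fun _ : ι => coinLaw ι p)).map graft = coinLaw ι p := by
  classical
  refine Measure.eq_infinitePi _ fun s t ht => ?_
  have hinj (k : ι) : Set.InjOn (fun u : List ι => k :: u)
      ((fun u => k :: u) ⁻¹' (s : Set (List ι))) :=
    fun u _ v _ h => (List.cons.inj h).2
  have hpre : graft ⁻¹' (Set.pi (s : Set (List ι)) t) =
      (if [] ∈ s then t [] else Set.univ) ×ˢ Set.pi Set.univ
        (fun k : ι => Set.pi ((s.preimage (fun u => k :: u) (hinj k) : Finset (List ι)) :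
          Set (List ι)) fun u => t (k :: u)) := by
    ext y
    simp only [Set.mem_preimage, Set.mem_pi, Set.mem_prod, Finset.mem_coe, Finset.mem_preimage]
    constructor
    · intro h
      refine ⟨?_, fun k _ u hu => h _ hu⟩
      split_ifs with h0
      · exact h _ h0
      · trivial
    · rintro ⟨h0, h1⟩ u hu
      cases u with
      | nil =>
        rw [if_pos hu] at h0
        exact h0
      | cons k u => exact h1 k trivial u hu
  rw [Measure.map_apply measurable_graft
    (MeasurableSet.pi s.countable_toSet fun i _ => ht i), hpre, Measure.prod_prod, Measure.pi_pi]
  have h1 (k : ι) := Measure.infinitePi_pi (μ := fun _ : List ι =>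
    Measure.pi fun _ : ι => bernoulliMeasure true false p)
    (s := s.preimage (fun u => k :: u) (hinj k)) (t := fun u => t (k :: u)) fun u _ => ht _
  simp only [coinLaw, h1]
  let g : List ι → ENNReal := fun u => (Measure.pi fun _ : ι => bernoulliMeasure true false p) (t u)
  change _ * ∏ k, ∏ u ∈ s.preimage (fun u => k :: u) (hinj k), g (k :: u) = ∏ u ∈ s, g u
  have h2 (k : ι) : ∏ u ∈ s.preimage (fun u => k :: u) (hinj k), g (k :: u) =
      ∏ v ∈ s with v.head? = some k, g v := by
    refine Finset.prod_bij (fun u _ => k :: u) ?_ ?_ ?_ ?_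
    · simp
    · intro u _ v _ h
      exact (List.cons.inj h).2
    · intro v hv
      cases v with
      | nil => simp at hv
      | cons k' u =>
        obtain ⟨h, h'⟩ := Finset.mem_filter.1 hv
        obtain rfl : k' = k := by simpa using h'
        exact ⟨u, Finset.mem_preimage.2 h, rfl⟩
    · simp
  have h3 : (Measure.pi fun _ : ι => bernoulliMeasure true false p)
      (if [] ∈ s then t [] else Set.univ) = ∏ v ∈ s with v.head? = none, g v := by
    have : s.filter (fun v => v.head? = none) = if [] ∈ s then {[]} else ∅ := by
      ext v
      cases v <;> split_ifs <;> simp_all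
    rw [this]
    split_ifs <;> simp [g]
  rw [h3]
  simp only [h2]
  -- The fibre of `List.head?` over `none` is the root, the one over `some k` the subtree below `k`.
  rw [← Finset.prod_fiberwise s List.head? g, Fintype.prod_option]

/-- The root tosses and the subtrees below the children of the root are independent. -/
theorem coinLaw_forall_shift (F : ι → Set (Sample ι)) (hF : ∀ k, MeasurableSet (F k)) :
    (coinLaw ι p).real {ω | ∀ k, ω [] k = true → shift k ω ∈ F k} =
      ∏ k, (1 - (p : ℝ) + p * (coinLaw ι p).real (F k)) := by
  have hS : MeasurableSet {ω : Sample ι | ∀ k, ω [] k = true → shift k ω ∈ F k} := by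
    simp only [Set.ofPred_forall]
    refine MeasurableSet.iInter fun k => ?_
    have : {ω : Sample ι | ω [] k = true → shift k ω ∈ F k} =
        {ω | ω [] k = true}ᶜ ∪ shift k ⁻¹' F k := by
      ext ω
      simp [imp_iff_not_or]
    rw [this]
    exact (measurableSet_root k).compl.union (measurable_shift k (hF k))
  let G : ι → Set (Bool × Sample ι) := fun k => {z | z.1 = true → z.2 ∈ F k}
  have hG' (k : ι) : G k = ({false} ×ˢ Set.univ) ∪ ({true} ×ˢ F k) := by
    ext ⟨b, z⟩
    cases b <;> simp [G]
  have hG (k : ι) : MeasurableSet (G k) := by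
    rw [hG']
    exact ((measurableSet_singleton _).prod .univ).union ((measurableSet_singleton _).prod (hF k))
  have hGm (k : ι) : ((bernoulliMeasure true false p).prod (coinLaw ι p)).real (G k) =
      1 - (p : ℝ) + p * (coinLaw ι p).real (F k) := by
    rw [hG', measureReal_union _ ((measurableSet_singleton _).prod (hF k)), measureReal_prod_prod,
      measureReal_prod_prod]
    · have h1 : (bernoulliMeasure true false p).real {true} = p :=
        bernoulliMeasure_real_apply_of_mem_of_notMem p (measurableSet_singleton _) (by simp)
          (by simp)
      have h2 : (bernoulliMeasure true false p).real {false} = 1 - p :=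
        (bernoulliMeasure_real_apply_of_notMem_of_mem p (measurableSet_singleton _) (by simp)
          (by simp)).trans (by simp)
      rw [h1, h2]
      simp
    · rw [Set.disjoint_left]
      rintro ⟨b, z⟩ ⟨h1, _⟩ ⟨h2, _⟩
      simp_all
  have h1 := measurePreserving_arrowProdEquivProdArrow Bool (Sample ι) ι
    (fun _ => bernoulliMeasure true false p) (fun _ => coinLaw ι p)
  have h2 : MeasurePreserving (fun y => graft (MeasurableEquiv.arrowProdEquivProdArrow Bool
      (Sample ι) ι y)) (Measure.pi fun _ : ι => (bernoulliMeasure true false p).prod (coinLaw ι p))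
      (coinLaw ι p) :=
    MeasurePreserving.comp ⟨measurable_graft, map_graft_coinLaw p⟩ h1
  rw [← h2.measureReal_preimage hS.nullMeasurableSet]
  have h3 : (fun y => graft (MeasurableEquiv.arrowProdEquivProdArrow Bool (Sample ι) ι y)) ⁻¹'
      {ω : Sample ι | ∀ k, ω [] k = true → shift k ω ∈ F k} = Set.pi Set.univ G := by
    ext y
    simp only [Set.mem_preimage, Set.mem_ofPred_eq, Set.mem_pi, Set.mem_univ, true_imp_iff,
      shift_graft]
    rfl
  rw [h3, measureReal_def, Measure.pi_pi, ENNReal.toReal_prod]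
  exact Finset.prod_congr rfl fun k _ => hGm k

end Tree
end MengerPercolation

/-! ### König's lemma and the zero-one dichotomy -/

namespace MengerPercolation

open MeasureTheory ProbabilityTheory

section Tree

variable {ι : Type*}

theorem length_of_mem_retained {ω : Sample ι} {n : ℕ} {w : List ι} (h : w ∈ retained ω n) :
    w.length = n := by
  induction n generalizing w with
  | zero =>
    obtain rfl : w = [] := h
    rfl
  | succ n ih =>
    obtain ⟨v, hv, k, -, rfl⟩ := h
    simp [ih hv]

theorem finite_retained [Finite ι] (ω : Sample ι) (n : ℕ) : (retained ω n).Finite :=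
  (List.finite_length_eq ι n).subset fun _ h => length_of_mem_retained h

/-- If each of finitely many decreasing families of statements fails eventually, then all of them
fail at a common time. -/
theorem exists_forall_of_forall_exists [Finite ι] {P : ι → ℕ → Prop}
    (hP : ∀ k n, P k (n + 1) → P k n) (h : ∀ n, ∃ k, P k n) : ∃ k, ∀ n, P k n := by
  by_contra! hc
  choose N hN using hc
  have hanti (k : ι) : Antitone (P k) := antitone_nat_of_succ_le (hP k)
  obtain ⟨M, hM⟩ := (Set.finite_range N).bddAbove
  obtain ⟨k, hk⟩ := h M
  exact hN k (hanti k (hM ⟨k, rfl⟩) hk)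

theorem retained_nonempty_of_succ {ω : Sample ι} {n : ℕ} (h : (retained ω (n + 1)).Nonempty) :
    (retained ω n).Nonempty := by
  obtain ⟨_, w, hw, -⟩ := h
  exact ⟨w, hw⟩

theorem retained_succ_nonempty_iff (ω : Sample ι) (n : ℕ) :
    (retained ω (n + 1)).Nonempty ↔ ∃ k, ω [] k = true ∧ (retained (shift k ω) n).Nonempty := by
  constructor
  · rintro ⟨v, hv⟩
    obtain ⟨k, hk, w, hw, -⟩ := (mem_retained_succ ω n v).1 hv
    exact ⟨k, hk, w, hw⟩
  · rintro ⟨k, hk, w, hw⟩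
    exact ⟨k :: w, (cons_mem_retained_succ ω n k w).2 ⟨hk, hw⟩⟩

theorem forall_retained_nonempty_iff [Finite ι] (ω : Sample ι) :
    (∀ n, (retained ω n).Nonempty) ↔
      ∃ k, ω [] k = true ∧ ∀ n, (retained (shift k ω) n).Nonempty := by
  constructor
  · intro h
    obtain ⟨k, hk⟩ := exists_forall_of_forall_exists
      (P := fun k n => ω [] k = true ∧ (retained (shift k ω) n).Nonempty)
      (fun k n h => ⟨h.1, retained_nonempty_of_succ h.2⟩)
      (fun n => (retained_succ_nonempty_iff ω n).1 (h (n + 1)))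
    exact ⟨k, (hk 0).1, fun n => (hk n).2⟩
  · rintro ⟨k, hk, h⟩ n
    exact retained_nonempty_of_succ ((retained_succ_nonempty_iff ω n).2 ⟨k, hk, h n⟩)

/-- König's lemma for the retained tree. -/
theorem mem_nonExtinction_iff [Finite ι] (ω : Sample ι) :
    ω ∈ nonExtinction ι ↔ ∀ n, (retained ω n).Nonempty := by
  constructor
  · rintro ⟨σ, hσ⟩ n
    exact ⟨_, hσ n⟩
  · intro h
    have : Nonempty ι := ((forall_retained_nonempty_iff ω).1 h).nonempty
    -- The infinite path follows a child with infinite progeny again and again; `next` passes to the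
    -- subtree below it.
    choose! child hopen hchild using fun ω' : Sample ι => (forall_retained_nonempty_iff ω').1
    let next : Sample ι → Sample ι := fun ω' => shift (child ω') ω'
    refine ⟨fun n => child (next^[n] ω), fun n => ?_⟩
    induction n generalizing ω with
    | zero => simp [retained]
    | succ n ih =>
      rw [List.ofFn_succ, cons_mem_retained_succ]
      refine ⟨hopen ω h, ?_⟩
      simpa [next] using ih (next ω) (hchild ω h)

theorem measurableSet_retained_nonempty [Finite ι] (n : ℕ) :
    MeasurableSet {ω : Sample ι | (retained ω n).Nonempty} := by
  induction n with
  | zero => simp [retained]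
  | succ n ih =>
    have : {ω : Sample ι | (retained ω (n + 1)).Nonempty} =
        ⋃ k, {ω | ω [] k = true} ∩ shift k ⁻¹' {ω | (retained ω n).Nonempty} := by
      ext ω
      simp [retained_succ_nonempty_iff]
    rw [this]
    exact MeasurableSet.iUnion fun k => (measurableSet_root k).inter (measurable_shift k ih)

theorem measurableSet_nonExtinction [Finite ι] : MeasurableSet (nonExtinction ι) := by
  have : nonExtinction ι = ⋂ n, {ω : Sample ι | (retained ω n).Nonempty} := by
    ext ω
    simp [mem_nonExtinction_iff]
  rw [this]
  exact MeasurableSet.iInter measurableSet_retained_nonempty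

/-- The generating function of a binomial distribution has at most one fixed point below `1`. -/
theorem eq_of_binomial_fixed_points {p e q : ℝ} {N : ℕ} (hN : 2 ≤ N) (hp0 : 0 < p) (hp1 : p ≤ 1)
    (he0 : 0 ≤ e) (heq : e ≤ q) (hq1 : q < 1) (he : (1 - p + p * e) ^ N = e)
    (hq : (1 - p + p * q) ^ N = q) : e = q := by
  by_contra hne
  have hlt : e < q := lt_of_le_of_ne heq hne
  have hd : 0 < 1 - e := by linarith
  have hc : StrictConvexOn ℝ (Set.Ici 0) fun x : ℝ => x ^ N := strictConvexOn_pow hN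
  have hx : 1 - p + p * e ∈ Set.Ici (0 : ℝ) := Set.mem_Ici.2 (by nlinarith)
  have hy : (1 : ℝ) ∈ Set.Ici (0 : ℝ) := Set.mem_Ici.2 zero_le_one
  have hxy : 1 - p + p * e ≠ 1 := by nlinarith
  -- These weights write `q` as a convex combination of the fixed points `e` and `1`; strict
  -- convexity then gives `(1 - p + p * q) ^ N < q`.
  have ha : 0 < (1 - q) / (1 - e) := div_pos (by linarith) hd
  have hb : 0 < (q - e) / (1 - e) := div_pos (by linarith) hd
  have hab : (1 - q) / (1 - e) + (q - e) / (1 - e) = 1 := by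
    field_simp
    ring
  have h := hc.2 hx hy hxy ha hb hab
  simp only [smul_eq_mul, one_pow, mul_one, he] at h
  have h1 : (1 - q) / (1 - e) * (1 - p + p * e) + (q - e) / (1 - e) = 1 - p + p * q := by
    field_simp
    ring
  have h2 : (1 - q) / (1 - e) * e + (q - e) / (1 - e) = q := by
    field_simp
    ring
  rw [h1, h2, hq] at h
  exact lt_irrefl _ h

/-- An inherited property that is implied by another one, and that does not hold almost surely,
agrees with it up to a null set. -/
theorem measure_diff_eq_zero_of_inherited [Fintype ι] (p : unitInterval) (hp : 0 < (p : ℝ))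
    (hcard : 2 ≤ Fintype.card ι) {A B : Set (Sample ι)} (hA : MeasurableSet A)
    (hB : MeasurableSet B) (hAB : A ⊆ B)
    (hA' : ∀ ω, ω ∈ A ↔ ∀ k, ω [] k = true → shift k ω ∈ A)
    (hB' : ∀ ω, ω ∈ B ↔ ∀ k, ω [] k = true → shift k ω ∈ B)
    (hB1 : (coinLaw ι p).real B < 1) : coinLaw ι p (B \ A) = 0 := by
  have key {F : Set (Sample ι)} (hF : MeasurableSet F)
      (hF' : ∀ ω, ω ∈ F ↔ ∀ k, ω [] k = true → shift k ω ∈ F) :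
      (1 - (p : ℝ) + p * (coinLaw ι p).real F) ^ Fintype.card ι = (coinLaw ι p).real F := by
    have h := coinLaw_forall_shift p (fun _ => F) fun _ => hF
    rw [Finset.prod_const, Finset.card_univ] at h
    rw [← h]
    congr 1
    ext ω
    exact (hF' ω).symm
  have h := eq_of_binomial_fixed_points hcard hp p.2.2 measureReal_nonneg (measureReal_mono hAB)
    hB1 (key hA hA') (key hB hB')
  rw [← measureReal_eq_zero_iff, measureReal_sdiff hAB hA, h, sub_self]

end Tree

/-! ### The projected approximations and their limit -/

/-- The sum of the coordinates of an index. -/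
def digitSum (d : MengerIndex) : ℕ := d.1 0 + d.1 1 + d.1 2

/-- The projection of the `n`-th approximation of the random Menger sponge. -/
def projLevel : ℕ → Sample MengerIndex → Set ℝ
  | 0, _ => Set.Icc 0 3
  | n + 1, ω => {x | ∃ d, ω [] d = true ∧ 3 * x - digitSum d ∈ projLevel n (shift d ω)}

theorem proj_mengerMap (d : MengerIndex) (x : EuclideanSpace ℝ (Fin 3)) :
    proj 1 1 1 (mengerMap d x) = (proj 1 1 1 x + digitSum d) / 3 := by
  simp only [proj, mengerMap, digitSum, PiLp.add_apply, PiLp.smul_apply, smul_eq_mul]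
  push_cast
  ring

/-- The `n`-th approximation of the random Menger sponge. -/
def level (n : ℕ) (ω : Sample MengerIndex) : Set (EuclideanSpace ℝ (Fin 3)) :=
  ⋃ w ∈ retained ω n, wordMap mengerMap w '' unitCube

theorem mem_level_succ (n : ℕ) (ω : Sample MengerIndex) (y : EuclideanSpace ℝ (Fin 3)) :
    y ∈ level (n + 1) ω ↔ ∃ d, ω [] d = true ∧ ∃ z ∈ level n (shift d ω), mengerMap d z = y := by
  simp only [level, Set.mem_iUnion, exists_prop]
  constructor
  · rintro ⟨v, hv, c, hc, rfl⟩
    obtain ⟨d, hd, w, hw, rfl⟩ := (mem_retained_succ ω n v).1 hv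
    exact ⟨d, hd, _, ⟨w, hw, c, hc, rfl⟩, rfl⟩
  · rintro ⟨d, hd, _, ⟨w, hw, c, hc, rfl⟩, rfl⟩
    exact ⟨d :: w, (cons_mem_retained_succ ω n d w).2 ⟨hd, hw⟩, c, hc, rfl⟩

theorem level_zero (ω : Sample MengerIndex) : level 0 ω = unitCube := by
  simp [level, retained, wordMap]

theorem antitone_level (ω : Sample MengerIndex) : Antitone fun n => level n ω := by
  refine antitone_nat_of_succ_le fun n => ?_
  induction n generalizing ω with
  | zero =>
    intro y hy
    obtain ⟨d, -, z, hz, rfl⟩ := (mem_level_succ 0 ω y).1 hy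
    rw [level_zero] at hz ⊢
    exact mengerMap_image_unitCube d ⟨z, hz, rfl⟩
  | succ n ih =>
    intro y hy
    obtain ⟨d, hd, z, hz, rfl⟩ := (mem_level_succ _ ω y).1 hy
    exact (mem_level_succ _ ω _).2 ⟨d, hd, z, ih _ hz, rfl⟩

theorem continuous_mengerMap (d : MengerIndex) : Continuous (mengerMap d) := by
  unfold mengerMap
  fun_prop

theorem isCompact_level (n : ℕ) (ω : Sample MengerIndex) : IsCompact (level n ω) := by
  have h (w : List MengerIndex) : Continuous (wordMap mengerMap w) := by
    induction w with
    | nil => exact continuous_id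
    | cons d w ih => exact (continuous_mengerMap d).comp ih
  exact (finite_retained ω n).isCompact_biUnion fun w _ => isCompact_unitCube.image (h w)

theorem continuous_proj : Continuous (proj 1 1 1) := by
  unfold proj
  fun_prop

theorem proj_image_unitCube : proj 1 1 1 '' unitCube = Set.Icc 0 3 := by
  ext x
  constructor
  · rintro ⟨y, hy, rfl⟩
    have h0 := hy 0
    have h1 := hy 1
    have h2 := hy 2
    simp only [Set.mem_Icc, proj] at *
    constructor <;> linarith
  · intro hx
    refine ⟨WithLp.toLp 2 fun _ => x / 3, fun j => ?_, ?_⟩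
    · simp only [Set.mem_Icc] at *
      constructor <;> linarith
    · simp only [proj]
      ring

theorem proj_image_level (n : ℕ) (ω : Sample MengerIndex) :
    proj 1 1 1 '' level n ω = projLevel n ω := by
  induction n generalizing ω with
  | zero => rw [level_zero, proj_image_unitCube, projLevel]
  | succ n ih =>
    ext x
    simp only [projLevel, ← ih, Set.mem_ofPred_eq]
    constructor
    · rintro ⟨y, hy, rfl⟩
      obtain ⟨d, hd, z, hz, rfl⟩ := (mem_level_succ n ω y).1 hy
      refine ⟨d, hd, z, hz, ?_⟩
      rw [proj_mengerMap]
      ring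
    · rintro ⟨d, hd, z, hz, h⟩
      refine ⟨mengerMap d z, (mem_level_succ n ω _).2 ⟨d, hd, z, hz, rfl⟩, ?_⟩
      rw [proj_mengerMap, h]
      ring

theorem antitone_projLevel (ω : Sample MengerIndex) : Antitone fun n => projLevel n ω := by
  intro m n h
  simp only [← proj_image_level]
  exact Set.image_mono (antitone_level ω h)

/-- The intersection of the projections of the approximations. -/
def projLimit (ω : Sample MengerIndex) : Set ℝ := ⋂ n, projLevel n ω

/-- Projection commutes with this intersection by compactness: the fibres over `x` in the levels are
nested nonempty compact sets. -/
theorem proj_image_randomMengerSponge (ω : Sample MengerIndex) :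
    proj 1 1 1 '' randomMengerSponge ω = projLimit ω := by
  have hM : randomMengerSponge ω = ⋂ n, level (n + 1) ω := rfl
  rw [hM]
  ext x
  constructor
  · rintro ⟨y, hy, rfl⟩
    refine Set.mem_iInter.2 fun n => antitone_projLevel ω (Nat.le_succ n) ?_
    simp only [← proj_image_level]
    exact ⟨y, Set.mem_iInter.1 hy n, rfl⟩
  · intro hx
    have hcl : IsClosed (proj 1 1 1 ⁻¹' {x}) := isClosed_singleton.preimage continuous_proj
    obtain ⟨y, hy⟩ := IsCompact.nonempty_iInter_of_sequence_nonempty_isCompact_isClosed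
      (fun n => level (n + 1) ω ∩ proj 1 1 1 ⁻¹' {x})
      (fun n => Set.inter_subset_inter_left _ (antitone_level ω (Nat.le_succ _)))
      (fun n => by
        have := Set.mem_iInter.1 hx (n + 1)
        rw [← proj_image_level] at this
        obtain ⟨y, hy, h⟩ := this
        exact ⟨y, hy, h⟩)
      ((isCompact_level _ ω).inter_right hcl)
      (fun n => (isCompact_level _ ω).isClosed.inter hcl)
    rw [Set.mem_iInter] at hy
    exact ⟨y, Set.mem_iInter.2 fun n => (hy n).1, (hy 0).2⟩

theorem mem_projLimit_iff (ω : Sample MengerIndex) (x : ℝ) :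
    x ∈ projLimit ω ↔ ∃ d, ω [] d = true ∧ 3 * x - digitSum d ∈ projLimit (shift d ω) := by
  simp only [projLimit, Set.mem_iInter]
  constructor
  · intro h
    obtain ⟨d, hd⟩ := exists_forall_of_forall_exists
      (P := fun d n => ω [] d = true ∧ 3 * x - digitSum d ∈ projLevel n (shift d ω))
      (fun d n h => ⟨h.1, antitone_projLevel _ (Nat.le_succ n) h.2⟩) (fun n => h (n + 1))
    exact ⟨d, (hd 0).1, fun n => (hd n).2⟩
  · rintro ⟨d, hd, h⟩ n
    exact antitone_projLevel ω (Nat.le_succ n) ⟨d, hd, h n⟩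

/-- The limit is a finite union of affine copies of the limits in the open subtrees. This is the
inheritance required by `measure_diff_eq_zero_of_inherited`. -/
theorem volume_projLimit_eq_zero_iff (ω : Sample MengerIndex) :
    volume (projLimit ω) = 0 ↔ ∀ d, ω [] d = true → volume (projLimit (shift d ω)) = 0 := by
  have hpre (d : MengerIndex) (S : Set ℝ) :
      volume ((fun x : ℝ => 3 * x - digitSum d) ⁻¹' S) = 0 ↔ volume S = 0 := by
    have h : (fun x : ℝ => 3 * x - digitSum d) ⁻¹' S =
        (fun x : ℝ => 3 * x) ⁻¹' ((fun x => x + (-(digitSum d : ℝ))) ⁻¹' S) := by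
      ext x
      simp [sub_eq_add_neg]
    rw [h, Real.volume_preimage_mul_left (by norm_num), measure_preimage_add_right]
    simp
  have hU : projLimit ω = ⋃ d, ⋃ (_ : ω [] d = true),
      (fun x : ℝ => 3 * x - digitSum d) ⁻¹' projLimit (shift d ω) := by
    ext x
    simp [mem_projLimit_iff ω x]
  rw [hU]
  simp only [measure_iUnion_null_iff, hpre]

theorem measurableSet_prod_projLevel (n : ℕ) :
    MeasurableSet {z : Sample MengerIndex × ℝ | z.2 ∈ projLevel n z.1} := by
  induction n with
  | zero => exact measurable_snd measurableSet_Icc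
  | succ n ih =>
    have : {z : Sample MengerIndex × ℝ | z.2 ∈ projLevel (n + 1) z.1} =
        ⋃ d, ((fun z : Sample MengerIndex × ℝ => z.1) ⁻¹' {ω | ω [] d = true}) ∩
          (fun z : Sample MengerIndex × ℝ => (shift d z.1, 3 * z.2 - digitSum d)) ⁻¹'
            {z | z.2 ∈ projLevel n z.1} := by
      ext z
      simp [projLevel]
    rw [this]
    refine MeasurableSet.iUnion fun d => (measurable_fst (measurableSet_root d)).inter ?_
    refine Measurable.prodMk ((measurable_shift d).comp measurable_fst) ?_ ih
    fun_prop

theorem measurableSet_prod_projLimit :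
    MeasurableSet {z : Sample MengerIndex × ℝ | z.2 ∈ projLimit z.1} := by
  have : {z : Sample MengerIndex × ℝ | z.2 ∈ projLimit z.1} =
      ⋂ n, {z | z.2 ∈ projLevel n z.1} := by
    ext z
    simp [projLimit]
  rw [this]
  exact MeasurableSet.iInter measurableSet_prod_projLevel

theorem measurableSet_volume_projLimit_eq_zero :
    MeasurableSet {ω | volume (projLimit ω) = 0} :=
  (measurable_measure_prodMk_left measurableSet_prod_projLimit) (measurableSet_singleton 0)

/-- If the projection is not almost surely a null set, then it has positive length almost surely
on non-extinction. -/
theorem positive_of_not_ae_null (p : unitInterval) (hp : 0 < (p : ℝ))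
    (h : (coinLaw MengerIndex p).real {ω | volume (projLimit ω) = 0} < 1) :
    0 < coinLaw MengerIndex p (nonExtinction MengerIndex) ∧
      ∀ᵐ ω ∂(cond (coinLaw MengerIndex p) (nonExtinction MengerIndex)),
        0 < volume (projLimit ω) := by
  have hext (ω : Sample MengerIndex) : ω ∈ (nonExtinction MengerIndex)ᶜ ↔
      ∀ k, ω [] k = true → shift k ω ∈ (nonExtinction MengerIndex)ᶜ := by
    rw [Set.mem_compl_iff, mem_nonExtinction_iff, forall_retained_nonempty_iff]
    simp only [Set.mem_compl_iff, mem_nonExtinction_iff]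
    push Not
    rfl
  have hsub : (nonExtinction MengerIndex)ᶜ ⊆ {ω | volume (projLimit ω) = 0} := by
    intro ω hω
    rw [Set.mem_compl_iff, mem_nonExtinction_iff] at hω
    obtain ⟨n, hn⟩ := not_forall.1 hω
    rw [Set.not_nonempty_iff_eq_empty] at hn
    have : projLevel n ω = ∅ := by
      rw [← proj_image_level, level, hn]
      simp
    have h0 : projLimit ω = ∅ := Set.subset_empty_iff.1 (this ▸ Set.iInter_subset _ n)
    simp [h0]
  have hpos : 0 < coinLaw MengerIndex p (nonExtinction MengerIndex) := by
    rw [pos_iff_ne_zero]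
    intro h0
    have h1 : (coinLaw MengerIndex p).real (nonExtinction MengerIndex)ᶜ = 1 := by
      rw [probReal_compl_eq_one_sub measurableSet_nonExtinction, measureReal_def, h0]
      simp
    have h2 := measureReal_mono (μ := coinLaw MengerIndex p) hsub
    linarith
  have hnull := measure_diff_eq_zero_of_inherited p hp
    (by rw [card_mengerIndex]; norm_num) measurableSet_nonExtinction.compl
    measurableSet_volume_projLimit_eq_zero hsub hext
    (fun ω => volume_projLimit_eq_zero_iff ω) h
  refine ⟨hpos, ?_⟩
  refine Measure.ae_smul_measure ?_ _
  rw [ae_restrict_iff' measurableSet_nonExtinction]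
  rw [ae_iff]
  refine measure_mono_null (fun ω hω => ?_) hnull
  simp only [Set.mem_ofPred_eq, not_forall, not_lt, nonpos_iff_eq_zero] at hω
  obtain ⟨h1, h2⟩ := hω
  exact ⟨h2, fun h => h h1⟩

end MengerPercolation

/-! ### Mean matrices and negative moments of their products -/

namespace MengerPercolation

open MeasureTheory ProbabilityTheory

open Matrix Filter Topology

/-- The number of level-one cubes of the Menger sponge whose projection has the digit data
`digitSum d + i = 3 * j + a`. -/
def digitCount (a j i : Fin 3) : ℕ :=
  (Finset.univ.filter fun d : MengerIndex => digitSum d + i.1 = 3 * j.1 + a.1).card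

/-- Both `digitSum d + i` and `3 * j + a` range over `0, …, 8`, so the sum counts the `d` with
`digitSum d ≡ a - i` mod `3`. The residues `0, 1, 2` occur `8, 6, 6` times. -/
theorem sum_digitCount (a i : Fin 3) : ∑ j, digitCount a j i = if a = i then 8 else 6 := by
  revert a i
  decide

/-- The expected numbers of open children, by the ternary digit `a` and the integer parts `j` of
the parent and `i` of the child. -/
def meanMatrix (p : ℝ) (a : Fin 3) : Matrix (Fin 3) (Fin 3) ℝ :=
  Matrix.of fun j i => p * digitCount a j i

theorem meanMatrix_apply (p : ℝ) (a j i : Fin 3) : meanMatrix p a j i = p * digitCount a j i := rfl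

theorem meanMatrix_nonneg {p : ℝ} (hp : 0 ≤ p) (a j i : Fin 3) : 0 ≤ meanMatrix p a j i :=
  mul_nonneg hp (Nat.cast_nonneg _)

theorem sum_meanMatrix (p : ℝ) (a i : Fin 3) :
    ∑ j, meanMatrix p a j i = if a = i then 8 * p else 6 * p := by
  simp only [meanMatrix_apply, ← Finset.mul_sum, ← Nat.cast_sum, sum_digitCount]
  split_ifs <;> push_cast <;> ring

theorem vecMul_meanMatrix_pos {p : ℝ} (hp : 0 < p) (a : Fin 3) {l : Fin 3 → ℝ} (hl : ∀ j, 0 < l j)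
    (i : Fin 3) : 0 < (l ᵥ* meanMatrix p a) i := by
  have hs : 0 < ∑ j, meanMatrix p a j i := by
    rw [sum_meanMatrix]
    split_ifs <;> linarith
  obtain ⟨j, -, hj⟩ := Finset.exists_lt_of_sum_lt
    (show ∑ _j : Fin 3, (0 : ℝ) < ∑ j, meanMatrix p a j i by simpa using hs)
  exact Finset.sum_pos' (fun k _ => mul_nonneg (hl k).le (meanMatrix_nonneg hp.le a k i))
    ⟨j, Finset.mem_univ j, mul_pos (hl j) hj⟩

/-- The average of `(l M v) ^ (-θ)` over all products `M` of `n` mean matrices. -/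
noncomputable def avgPow (p θ : ℝ) : ℕ → (Fin 3 → ℝ) → (Fin 3 → ℝ) → ℝ
  | 0, l, v => (l ⬝ᵥ v) ^ (-θ)
  | n + 1, l, v => (1 / 3) * ∑ a, avgPow p θ n (l ᵥ* meanMatrix p a) v

/-- The survival recursion multiplies matrices onto the left vector, but the column sums control
their action on the right one, so factors must be removable at either end. -/
theorem avgPow_succ' (p θ : ℝ) (n : ℕ) (l v : Fin 3 → ℝ) :
    avgPow p θ (n + 1) l v = (1 / 3) * ∑ a, avgPow p θ n l (meanMatrix p a *ᵥ v) := by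
  induction n generalizing l with
  | zero => simp only [avgPow, dotProduct_mulVec]
  | succ n ih =>
    rw [avgPow]
    simp only [ih]
    simp only [avgPow, ← Finset.mul_sum]
    rw [Finset.sum_comm]

/-- The mean of the `-θ`-th powers of the column sums of the mean matrices. -/
noncomputable def rate (p θ : ℝ) : ℝ := (1 / 3) * ((8 * p) ^ (-θ) + 2 * (6 * p) ^ (-θ))

theorem rate_nonneg {p : ℝ} (hp : 0 ≤ p) (θ : ℝ) : 0 ≤ rate p θ := by
  unfold rate
  positivity

/-- Jensen's inequality for negative powers. -/
theorem rpow_neg_sum_le {ι : Type*} (s : Finset ι) (u c : ι → ℝ) (hu : ∀ i ∈ s, 0 ≤ u i)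
    (hu1 : ∑ i ∈ s, u i = 1) (hc : ∀ i ∈ s, 0 < c i) {θ : ℝ} (hθ : 0 ≤ θ) :
    (∑ i ∈ s, u i * c i) ^ (-θ) ≤ ∑ i ∈ s, u i * c i ^ (-θ) := by
  -- AM-GM is used twice, for `c` and for `c ^ (-θ)`; the `-θ`-th power of the first geometric mean
  -- is the second one.
  have h1 := Real.geom_mean_le_arith_mean_weighted s u c hu hu1 fun i hi => (hc i hi).le
  have h2 := Real.geom_mean_le_arith_mean_weighted s u (fun i => c i ^ (-θ)) hu hu1
    fun i hi => (Real.rpow_pos_of_pos (hc i hi) _).le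
  refine le_trans (Real.rpow_le_rpow_of_nonpos
    (Finset.prod_pos fun i hi => Real.rpow_pos_of_pos (hc i hi) _) h1 (neg_nonpos.2 hθ)) ?_
  refine le_trans (le_of_eq ?_) h2
  rw [← Real.finsetProd_rpow _ _ fun i hi => (Real.rpow_pos_of_pos (hc i hi) _).le]
  refine Finset.prod_congr rfl fun i hi => ?_
  rw [← Real.rpow_mul (hc i hi).le, ← Real.rpow_mul (hc i hi).le, mul_comm]

/-- The coordinate sum of the image is `∑ i, v i` times an average of column sums with weights `v i
/ ∑ v`, to which Jensen applies. -/
theorem avg_meanMatrix_rpow_le {p θ : ℝ} (hp : 0 < p) (hθ : 0 ≤ θ) {v : Fin 3 → ℝ}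
    (hv : ∀ i, 0 ≤ v i) (hs : 0 < ∑ i, v i) :
    (1 / 3) * ∑ a, (∑ j, (meanMatrix p a *ᵥ v) j) ^ (-θ) ≤ rate p θ * (∑ i, v i) ^ (-θ) := by
  set S := ∑ i, v i with hS
  have hsum (a : Fin 3) : ∑ j, (meanMatrix p a *ᵥ v) j =
      S * ∑ i, v i / S * (if a = i then 8 * p else 6 * p) := by
    simp only [mulVec, dotProduct]
    rw [Finset.sum_comm, Finset.mul_sum]
    refine Finset.sum_congr rfl fun i _ => ?_
    rw [← Finset.sum_mul, sum_meanMatrix]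
    field_simp
  have hu1 : ∑ i, v i / S = 1 := by rw [← Finset.sum_div, ← hS, div_self hs.ne']
  have hle (a : Fin 3) : (∑ j, (meanMatrix p a *ᵥ v) j) ^ (-θ) ≤
      S ^ (-θ) * ∑ i, v i / S * (if a = i then 8 * p else 6 * p) ^ (-θ) := by
    rw [hsum, Real.mul_rpow hs.le
      (Finset.sum_nonneg fun i _ => mul_nonneg (div_nonneg (hv i) hs.le) (by split_ifs <;> linarith))]
    refine mul_le_mul_of_nonneg_left ?_ (Real.rpow_nonneg hs.le _)
    exact rpow_neg_sum_le _ _ _ (fun i _ => div_nonneg (hv i) hs.le) hu1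
      (fun i _ => by split_ifs <;> linarith) hθ
  -- For each column exactly one digit gives `8p`, so the weights `v i / S` drop out of the average.
  have hr (i : Fin 3) : ∑ a : Fin 3, (if a = i then 8 * p else 6 * p) ^ (-θ) = 3 * rate p θ := by
    fin_cases i <;> simp [Fin.sum_univ_three, rate] <;> ring
  calc (1 / 3) * ∑ a, (∑ j, (meanMatrix p a *ᵥ v) j) ^ (-θ)
      ≤ (1 / 3) * ∑ a : Fin 3,
        S ^ (-θ) * ∑ i, v i / S * (if a = i then 8 * p else 6 * p) ^ (-θ) := by
        gcongr with a
        exact hle a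
    _ = rate p θ * S ^ (-θ) := by
        rw [← Finset.mul_sum, Finset.sum_comm]
        simp only [← Finset.mul_sum, hr]
        rw [← Finset.sum_mul, hu1]
        ring

theorem avgPow_one_le {p θ : ℝ} (hp : 0 < p) (hθ : 0 ≤ θ) (n : ℕ) {v : Fin 3 → ℝ}
    (hv : ∀ i, 0 ≤ v i) (hs : 0 < ∑ i, v i) :
    avgPow p θ n 1 v ≤ rate p θ ^ n * (∑ i, v i) ^ (-θ) := by
  induction n generalizing v with
  | zero => simp [avgPow, one_dotProduct]
  | succ n ih =>
    have hv' (a j : Fin 3) : 0 ≤ (meanMatrix p a *ᵥ v) j := by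
      simp only [mulVec, dotProduct]
      exact Finset.sum_nonneg fun i _ => mul_nonneg (meanMatrix_nonneg hp.le a j i) (hv i)
    have hs' (a : Fin 3) : 0 < ∑ j, (meanMatrix p a *ᵥ v) j := by
      have : ∑ j, (meanMatrix p a *ᵥ v) j = ∑ i, (if a = i then 8 * p else 6 * p) * v i := by
        simp only [mulVec, dotProduct]
        rw [Finset.sum_comm]
        simp only [← Finset.sum_mul, sum_meanMatrix]
      rw [this]
      refine lt_of_lt_of_le (mul_pos (by linarith : 0 < 6 * p) hs) ?_
      rw [Finset.mul_sum]
      refine Finset.sum_le_sum fun i _ => mul_le_mul_of_nonneg_right ?_ (hv i)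
      split_ifs <;> linarith
    calc avgPow p θ (n + 1) 1 v
        = (1 / 3) * ∑ a, avgPow p θ n 1 (meanMatrix p a *ᵥ v) := avgPow_succ' ..
      _ ≤ (1 / 3) * ∑ a, rate p θ ^ n * (∑ j, (meanMatrix p a *ᵥ v) j) ^ (-θ) := by
        gcongr with a
        exact ih (hv' a) (hs' a)
      _ = rate p θ ^ n * ((1 / 3) * ∑ a, (∑ j, (meanMatrix p a *ᵥ v) j) ^ (-θ)) := by
        rw [← Finset.mul_sum]
        ring
      _ ≤ rate p θ ^ n * (rate p θ * (∑ i, v i) ^ (-θ)) :=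
        mul_le_mul_of_nonneg_left (avg_meanMatrix_rpow_le hp hθ hv hs)
          (pow_nonneg (rate_nonneg hp.le θ) n)
      _ = rate p θ ^ (n + 1) * (∑ i, v i) ^ (-θ) := by ring

theorem avgPow_nonneg {p θ : ℝ} (hp : 0 < p) (n : ℕ) {l : Fin 3 → ℝ} (hl : ∀ j, 0 < l j)
    {v : Fin 3 → ℝ} (hv : ∀ j, 0 ≤ v j) : 0 ≤ avgPow p θ n l v := by
  induction n generalizing l with
  | zero => exact Real.rpow_nonneg (Finset.sum_nonneg fun j _ => mul_nonneg (hl j).le (hv j)) _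
  | succ n ih =>
    exact mul_nonneg (by norm_num) (Finset.sum_nonneg fun a _ =>
      ih (vecMul_meanMatrix_pos hp a hl))

/-- The bound for the negative moments of the survival probabilities up to generation `n`. -/
noncomputable def momentBound (p θ : ℝ) (n : ℕ) (l : Fin 3 → ℝ) : ℝ :=
  ∑ m ∈ Finset.range (n + 1), ∑ j, avgPow p θ m l (Pi.single j 1)

theorem momentBound_succ (p θ : ℝ) (n : ℕ) (l : Fin 3 → ℝ) :
    momentBound p θ (n + 1) l = ∑ j, l j ^ (-θ) +
      (1 / 3) * ∑ a, momentBound p θ n (l ᵥ* meanMatrix p a) := by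
  unfold momentBound
  rw [Finset.sum_range_succ']
  simp only [avgPow, dotProduct_single, mul_one]
  rw [add_comm]
  congr 1
  rw [Finset.sum_comm (s := Finset.univ), Finset.mul_sum]
  refine Finset.sum_congr rfl fun m _ => ?_
  rw [Finset.sum_comm, ← Finset.mul_sum]

theorem momentBound_nonneg {p θ : ℝ} (hp : 0 < p) (n : ℕ) {l : Fin 3 → ℝ} (hl : ∀ j, 0 < l j) :
    0 ≤ momentBound p θ n l := by
  refine Finset.sum_nonneg fun m _ => Finset.sum_nonneg fun j _ => avgPow_nonneg hp m hl fun i => ?_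
  by_cases h : i = j
  · subst h
    simp
  · simp [h]

theorem momentBound_one_le {p θ : ℝ} (hp : 0 < p) (hθ : 0 ≤ θ) (hr : rate p θ < 1) (n : ℕ) :
    momentBound p θ n 1 ≤ 3 / (1 - rate p θ) := by
  have h1 (m : ℕ) (j : Fin 3) : avgPow p θ m 1 (Pi.single j 1) ≤ rate p θ ^ m := by
    have h : ∑ i, (Pi.single j 1 : Fin 3 → ℝ) i = 1 := by simp
    have := avgPow_one_le hp hθ m (v := Pi.single j 1) (fun i => by
      by_cases h : i = j
      · subst h
        simp
      · simp [h]) (by rw [h]; exact one_pos)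
    rwa [h, Real.one_rpow, mul_one] at this
  calc momentBound p θ n 1 ≤ ∑ m ∈ Finset.range (n + 1), ∑ _j : Fin 3, rate p θ ^ m :=
        Finset.sum_le_sum fun m _ => Finset.sum_le_sum fun j _ => h1 m j
    _ = 3 * ∑ m ∈ Finset.range (n + 1), rate p θ ^ m := by
        rw [Finset.mul_sum]
        simp
    _ ≤ 3 * (1 - rate p θ)⁻¹ := by
        have h0 := rate_nonneg hp.le θ
        have := (summable_geometric_of_lt_one h0 hr).sum_le_tsum (Finset.range (n + 1))
          fun i _ => pow_nonneg h0 i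
        rw [tsum_geometric_of_lt_one h0 hr] at this
        linarith
    _ = 3 / (1 - rate p θ) := by rw [div_eq_mul_inv]

/-- Above the threshold, some small negative moment contracts. -/
theorem exists_rate_lt_one {p : ℝ} (hp : (8 * 6 * 6 : ℝ) ^ (-(1 / 3 : ℝ)) < p) :
    ∃ θ, 0 < θ ∧ θ < 1 ∧ rate p θ < 1 := by
  have hp0 : 0 < p := lt_trans (Real.rpow_pos_of_pos (by norm_num) _) hp
  -- This is `0 < log(8 * 6 * 6 * p ^ 3)`, the threshold condition in logarithmic form.
  have hlog : 0 < Real.log (8 * p) + 2 * Real.log (6 * p) := by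
    have h1 : Real.log (8 * p) + 2 * Real.log (6 * p) = Real.log (8 * 6 * 6) + 3 * Real.log p := by
      rw [Real.log_mul (by norm_num) hp0.ne', Real.log_mul (by norm_num) hp0.ne',
        Real.log_mul (by norm_num) (by norm_num), Real.log_mul (by norm_num) (by norm_num)]
      ring
    have h2 := Real.log_lt_log (Real.rpow_pos_of_pos (by norm_num) _) hp
    rw [Real.log_rpow (by norm_num)] at h2
    rw [h1]
    generalize Real.log (8 * 6 * 6) = L at h2 ⊢
    linarith
  have hd (c : ℝ) (hc : 0 < c) : HasDerivAt (fun θ : ℝ => c ^ (-θ)) (-Real.log c) 0 := by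
    have := (hasDerivAt_neg (0 : ℝ)).const_rpow hc
    simpa using this
  have hder : HasDerivAt (rate p)
      ((1 / 3) * (-Real.log (8 * p) + 2 * -Real.log (6 * p))) 0 :=
    ((hd _ (by linarith)).add ((hd _ (by linarith)).const_mul 2)).const_mul (1 / 3)
  have hneg : (1 / 3) * (-Real.log (8 * p) + 2 * -Real.log (6 * p)) < 0 := by linarith
  have h0 : rate p 0 = 1 := by
    unfold rate
    simp
    norm_num
  have hev : ∀ᶠ θ in 𝓝[>] (0 : ℝ), slope (rate p) 0 θ < 0 :=
    ((hasDerivAt_iff_tendsto_slope.1 hder).eventually (gt_mem_nhds hneg)).filter_mono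
      (nhdsWithin_mono _ fun x hx => ne_of_gt hx)
  obtain ⟨θ, hs, hθ⟩ := (hev.and (Ioo_mem_nhdsGT (zero_lt_one' ℝ))).exists
  refine ⟨θ, hθ.1, hθ.2, ?_⟩
  rw [slope_def_field, h0, sub_zero, div_lt_iff₀ hθ.1] at hs
  linarith

/-- The survival inequality in one generation. -/
theorem rpow_neg_dotProduct_le {θ : ℝ} (hθ0 : 0 ≤ θ) (hθ1 : θ ≤ 1) {l y s : Fin 3 → ℝ}
    (hl : ∀ j, 0 < l j) (hy : ∀ j, 0 ≤ y j) (hpos : 0 < l ⬝ᵥ y)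
    (hs : ∀ j, y j / (1 + y j) ≤ s j) :
    0 < l ⬝ᵥ s ∧ (l ⬝ᵥ s) ^ (-θ) ≤ ∑ j, l j ^ (-θ) + (l ⬝ᵥ y) ^ (-θ) := by
  -- With `l i` minimal, every `y j` is at most `Y / l i`. One common denominator `1 + Y / l i` then
  -- gives `l ⬝ᵥ s ≥ (Y⁻¹ + (l i)⁻¹)⁻¹`, and subadditivity of the `θ`-th power separates the two
  -- terms.
  obtain ⟨i, -, hi⟩ := Finset.exists_min_image Finset.univ l Finset.univ_nonempty
  set Y := l ⬝ᵥ y with hY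
  have hyj (j : Fin 3) : y j ≤ Y / l i := by
    rw [le_div_iff₀ (hl i)]
    calc y j * l i ≤ l j * y j := by
          rw [mul_comm]
          exact mul_le_mul_of_nonneg_right (hi j (Finset.mem_univ j)) (hy j)
      _ ≤ Y := Finset.single_le_sum (f := fun j => l j * y j)
          (fun k _ => mul_nonneg (hl k).le (hy k)) (Finset.mem_univ j)
  have hc : 0 < Y⁻¹ + (l i)⁻¹ := add_pos (inv_pos.2 hpos) (inv_pos.2 (hl i))
  have hlow : (Y⁻¹ + (l i)⁻¹)⁻¹ ≤ l ⬝ᵥ s := by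
    have h1 : (Y⁻¹ + (l i)⁻¹)⁻¹ = Y / (1 + Y / l i) := by
      have := (hl i).ne'
      field_simp
    have hden : 0 < 1 + Y / l i := add_pos one_pos (div_pos hpos (hl i))
    rw [h1, hY, dotProduct, dotProduct, Finset.sum_div]
    refine Finset.sum_le_sum fun j _ => ?_
    rw [mul_div_assoc]
    refine mul_le_mul_of_nonneg_left (le_trans ?_ (hs j)) (hl j).le
    exact div_le_div_of_nonneg_left (hy j) (by linarith [hy j]) (by
      have := hyj j
      simp only [hY, dotProduct] at this
      linarith)
  refine ⟨lt_of_lt_of_le (inv_pos.2 hc) hlow, ?_⟩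
  calc (l ⬝ᵥ s) ^ (-θ) ≤ ((Y⁻¹ + (l i)⁻¹)⁻¹) ^ (-θ) :=
        Real.rpow_le_rpow_of_nonpos (inv_pos.2 hc) hlow (neg_nonpos.2 hθ0)
    _ = (Y⁻¹ + (l i)⁻¹) ^ θ := by
        rw [Real.rpow_neg (inv_pos.2 hc).le, Real.inv_rpow hc.le, inv_inv]
    _ ≤ (Y⁻¹) ^ θ + ((l i)⁻¹) ^ θ :=
        Real.rpow_add_le_add_rpow (inv_pos.2 hpos).le (inv_pos.2 (hl i)).le hθ0 hθ1
    _ = Y ^ (-θ) + l i ^ (-θ) := by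
        rw [Real.inv_rpow hpos.le, Real.inv_rpow (hl i).le, Real.rpow_neg hpos.le,
          Real.rpow_neg (hl i).le]
    _ ≤ ∑ j, l j ^ (-θ) + Y ^ (-θ) := by
        have := Finset.single_le_sum (f := fun j => l j ^ (-θ))
          (fun k _ => Real.rpow_nonneg (hl k).le _) (Finset.mem_univ i)
        linarith

end MengerPercolation

/-! ### Recursion and negative moments for the covering probabilities -/

namespace MengerPercolation

open MeasureTheory ProbabilityTheory

open Matrix Filter Topology

theorem prod_one_sub_mul_one_add_sum_le {ι : Type*} (s : Finset ι) (a : ι → ℝ)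
    (h0 : ∀ i, 0 ≤ a i) (h1 : ∀ i, a i ≤ 1) :
    (∏ i ∈ s, (1 - a i)) * (1 + ∑ i ∈ s, a i) ≤ 1 := by
  classical
  induction s using Finset.induction_on with
  | empty => simp
  | insert i s hi ih =>
    rw [Finset.prod_insert hi, Finset.sum_insert hi]
    have hS : 0 ≤ ∑ i ∈ s, a i := Finset.sum_nonneg fun i _ => h0 i
    have hP : 0 ≤ ∏ i ∈ s, (1 - a i) := Finset.prod_nonneg fun i _ => sub_nonneg.2 (h1 i)
    have := mul_nonneg hP (add_nonneg (mul_nonneg (h0 i) (h0 i)) (mul_nonneg (h0 i) hS))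
    nlinarith

/-- The probability that the projection of the `n`-th approximation contains `x`. -/
noncomputable def coverProb (p : unitInterval) (n : ℕ) (x : ℝ) : ℝ :=
  (coinLaw MengerIndex p).real {ω | x ∈ projLevel n ω}

theorem measurableSet_mem_projLevel (n : ℕ) (x : ℝ) :
    MeasurableSet {ω : Sample MengerIndex | x ∈ projLevel n ω} :=
  measurable_prodMk_right (measurableSet_prod_projLevel n)

theorem coverProb_nonneg (p : unitInterval) (n : ℕ) (x : ℝ) : 0 ≤ coverProb p n x :=
  measureReal_nonneg

theorem coverProb_le_one (p : unitInterval) (n : ℕ) (x : ℝ) : coverProb p n x ≤ 1 :=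
  measureReal_le_one

theorem measurable_coverProb (p : unitInterval) (n : ℕ) : Measurable (coverProb p n) :=
  (measurable_measure_prodMk_right (measurableSet_prod_projLevel n)).ennreal_toReal

theorem one_sub_coverProb_succ (p : unitInterval) (n : ℕ) (x : ℝ) :
    1 - coverProb p (n + 1) x = ∏ d, (1 - (p : ℝ) * coverProb p n (3 * x - digitSum d)) := by
  have h := coinLaw_forall_shift p
    (fun d : MengerIndex => {ω | 3 * x - digitSum d ∈ projLevel n ω}ᶜ)
    (fun d => (measurableSet_mem_projLevel n _).compl)
  have hc : {ω : Sample MengerIndex | ∀ k, ω [] k = true →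
      shift k ω ∈ {ω | 3 * x - digitSum k ∈ projLevel n ω}ᶜ} =
      {ω | x ∈ projLevel (n + 1) ω}ᶜ := by
    ext ω
    simp [projLevel]
  rw [hc, probReal_compl_eq_one_sub (measurableSet_mem_projLevel _ _)] at h
  rw [coverProb, h]
  refine Finset.prod_congr rfl fun d _ => ?_
  rw [probReal_compl_eq_one_sub (measurableSet_mem_projLevel _ _), coverProb]
  ring

/-- The covering probabilities at the three points `t`, `1 + t` and `2 + t`. -/
noncomputable def coverVec (p : unitInterval) (n : ℕ) (t : ℝ) (j : Fin 3) : ℝ :=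
  coverProb p n ((j.1 : ℝ) + t)

/-- When `digitSum d + i = 3 * j + a`, the rescaled point is `i + t`. Indices `d` with no such `i`
in `Fin 3` are dropped, hence only an inequality. -/
theorem mulVec_coverVec_le (p : unitInterval) (n : ℕ) (a : Fin 3) (t : ℝ) (j : Fin 3) :
    (meanMatrix p a *ᵥ coverVec p n t) j ≤
      ∑ d, (p : ℝ) * coverProb p n (3 * ((j.1 : ℝ) + (a.1 + t) / 3) - digitSum d) := by
  set g : MengerIndex → ℝ :=
    fun d => (p : ℝ) * coverProb p n (3 * ((j.1 : ℝ) + (a.1 + t) / 3) - digitSum d) with hg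
  let F : Fin 3 → Finset MengerIndex :=
    fun i => Finset.univ.filter fun d : MengerIndex => digitSum d + i.1 = 3 * j.1 + a.1
  have h1 : (meanMatrix p a *ᵥ coverVec p n t) j = ∑ i, ∑ d ∈ F i, g d := by
    simp only [mulVec, dotProduct]
    refine Finset.sum_congr rfl fun i _ => ?_
    have : ∀ d ∈ F i, g d = p * coverVec p n t i := by
      intro d hd
      have hd' : digitSum d + i.1 = 3 * j.1 + a.1 := (Finset.mem_filter.1 hd).2
      have hd'' : (digitSum d : ℝ) + i.1 = 3 * j.1 + a.1 := by exact_mod_cast hd'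
      simp only [hg, coverVec]
      congr 2
      linarith
    rw [Finset.sum_congr rfl this, Finset.sum_const, meanMatrix_apply, nsmul_eq_mul]
    simp only [digitCount, F]
    ring
  rw [h1, ← Finset.sum_biUnion]
  · exact Finset.sum_le_sum_of_subset_of_nonneg (Finset.subset_univ _)
      fun d _ _ => mul_nonneg p.2.1 (coverProb_nonneg p n _)
  · intro i _ i' _ hne
    refine Finset.disjoint_left.2 fun d hd hd' => hne (Fin.ext ?_)
    have h := (Finset.mem_filter.1 hd).2
    have h' := (Finset.mem_filter.1 hd').2
    omega

theorem mulVec_coverVec_nonneg (p : unitInterval) (n : ℕ) (a : Fin 3) (t : ℝ) (j : Fin 3) :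
    0 ≤ (meanMatrix p a *ᵥ coverVec p n t) j := by
  simp only [mulVec, dotProduct]
  exact Finset.sum_nonneg fun i _ =>
    mul_nonneg (meanMatrix_nonneg p.2.1 a j i) (coverProb_nonneg p n _)

/-- The probability of not covering is a product of factors `1 - a_d`, hence at most `1 / (1 + ∑
a_d)`, and `∑ a_d` dominates the entry of the matrix product. -/
theorem coverVec_succ_ge (p : unitInterval) (n : ℕ) (a : Fin 3) (t : ℝ) (j : Fin 3) :
    (meanMatrix p a *ᵥ coverVec p n t) j / (1 + (meanMatrix p a *ᵥ coverVec p n t) j) ≤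
      coverVec p (n + 1) ((a.1 + t) / 3) j := by
  have hle := mulVec_coverVec_le p n a t j
  have hy := mulVec_coverVec_nonneg p n a t j
  set y := (meanMatrix p a *ᵥ coverVec p n t) j
  have hsub := one_sub_coverProb_succ p n ((j.1 : ℝ) + (a.1 + t) / 3)
  have hprod := prod_one_sub_mul_one_add_sum_le Finset.univ
    (fun d => (p : ℝ) * coverProb p n (3 * ((j.1 : ℝ) + (a.1 + t) / 3) - digitSum d))
    (fun d => mul_nonneg p.2.1 (coverProb_nonneg p n _))
    (fun d => mul_le_one₀ p.2.2 (coverProb_nonneg p n _) (coverProb_le_one p n _))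
  rw [← hsub] at hprod
  have h1 := coverProb_le_one p (n + 1) ((j.1 : ℝ) + (a.1 + t) / 3)
  rw [div_le_iff₀ (by linarith), coverVec]
  have := mul_le_mul_of_nonneg_left (add_le_add_right hle 1) (sub_nonneg.2 h1)
  nlinarith

theorem setLIntegral_Ico_zero_three (H : ℝ → ENNReal) :
    ∫⁻ t in Set.Ico (0 : ℝ) 3, H t = ∑ a : Fin 3, ∫⁻ t in Set.Ico (0 : ℝ) 1, H (a.1 + t) := by
  have hshift (c : ℝ) : ∫⁻ t in Set.Ico (0 : ℝ) 1, H (c + t) =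
      ∫⁻ t in Set.Ico c (c + 1), H t := by
    rw [← lintegral_indicator measurableSet_Ico, ← lintegral_indicator measurableSet_Ico,
      ← lintegral_add_left_eq_self (μ := volume) (Set.indicator (Set.Ico c (c + 1)) H) c]
    refine lintegral_congr fun t => ?_
    by_cases ht : t ∈ Set.Ico (0 : ℝ) 1
    · rw [Set.indicator_of_mem ht, Set.indicator_of_mem]
      exact ⟨by linarith [ht.1], by linarith [ht.2]⟩
    · rw [Set.indicator_of_notMem ht, Set.indicator_of_notMem]
      exact fun h => ht ⟨by linarith [h.1], by linarith [h.2]⟩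
  simp only [hshift, Fin.sum_univ_three]
  rw [← Set.Ico_union_Ico_eq_Ico (show (0 : ℝ) ≤ 2 by norm_num) (show (2 : ℝ) ≤ 3 by norm_num),
    lintegral_union measurableSet_Ico (Set.Ico_disjoint_Ico_same),
    ← Set.Ico_union_Ico_eq_Ico (show (0 : ℝ) ≤ 1 by norm_num) (show (1 : ℝ) ≤ 2 by norm_num),
    lintegral_union measurableSet_Ico (Set.Ico_disjoint_Ico_same)]
  norm_num

/-- Under Lebesgue measure on `[0, 1)` the first ternary digit is uniform, and the rescaled
remainder is again Lebesgue distributed; this matches the factor `1 / 3` in `avgPow`. -/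
theorem setLIntegral_Ico_zero_one {G : ℝ → ENNReal} (hG : Measurable G) :
    ∫⁻ t in Set.Ico (0 : ℝ) 1, G t =
      ENNReal.ofReal (1 / 3) * ∑ a : Fin 3, ∫⁻ t in Set.Ico (0 : ℝ) 1, G ((a.1 + t) / 3) := by
  rw [← setLIntegral_Ico_zero_three fun t => G (t / 3)]
  conv_lhs => rw [← lintegral_indicator measurableSet_Ico,
    ← Real.smul_map_volume_mul_left (show (1 / 3 : ℝ) ≠ 0 by norm_num)]
  rw [lintegral_smul_measure, lintegral_map (hG.indicator measurableSet_Ico) (by fun_prop),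
    ← lintegral_indicator measurableSet_Ico, smul_eq_mul, abs_of_pos (by norm_num)]
  congr 1
  refine lintegral_congr fun t => ?_
  by_cases ht : t ∈ Set.Ico (0 : ℝ) 3
  · rw [Set.indicator_of_mem ht, Set.indicator_of_mem]
    · congr 1
      ring
    · exact ⟨by linarith [ht.1], by linarith [ht.2]⟩
  · rw [Set.indicator_of_notMem ht, Set.indicator_of_notMem]
    exact fun h => ht ⟨by linarith [h.1], by linarith [h.2]⟩

theorem measurable_dotProduct_coverVec (p : unitInterval) (n : ℕ) (l : Fin 3 → ℝ) :
    Measurable fun t => l ⬝ᵥ coverVec p n t := by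
  simp only [dotProduct, coverVec]
  exact Finset.measurable_fun_sum _ fun j _ =>
    ((measurable_coverProb p n).comp (measurable_const_add _)).const_mul _

theorem coverVec_zero (p : unitInterval) {t : ℝ} (ht : t ∈ Set.Ico (0 : ℝ) 1) (j : Fin 3) :
    coverVec p 0 t j = 1 := by
  have hj : (j.1 : ℝ) ≤ 2 := by exact_mod_cast Nat.le_of_lt_succ j.2
  have h : ((j.1 : ℝ) + t) ∈ Set.Icc (0 : ℝ) 3 :=
    ⟨add_nonneg (Nat.cast_nonneg _) ht.1, by linarith [ht.2]⟩
  simp [coverVec, coverProb, projLevel, h]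

theorem exists_ternary_digit {t : ℝ} (ht : t ∈ Set.Ico (0 : ℝ) 1) :
    ∃ a : Fin 3, ∃ u ∈ Set.Ico (0 : ℝ) 1, t = (a.1 + u) / 3 := by
  rcases lt_or_ge t (1 / 3) with h | h
  · exact ⟨0, 3 * t, ⟨by linarith [ht.1], by linarith⟩, by simp⟩
  rcases lt_or_ge t (2 / 3) with h' | h'
  · exact ⟨1, 3 * t - 1, ⟨by linarith [ht.1], by linarith⟩, by simp⟩
  · exact ⟨2, 3 * t - 2, ⟨by linarith [ht.1], by linarith [ht.2]⟩, by simp⟩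

variable {p : unitInterval} {θ : ℝ}

theorem dotProduct_coverVec_succ (hθ0 : 0 ≤ θ) (hθ1 : θ ≤ 1) {n : ℕ}
    {l : Fin 3 → ℝ} (hl : ∀ j, 0 < l j) (a : Fin 3) {t : ℝ}
    (h : 0 < (l ᵥ* meanMatrix p a) ⬝ᵥ coverVec p n t) :
    0 < l ⬝ᵥ coverVec p (n + 1) ((a.1 + t) / 3) ∧
      (l ⬝ᵥ coverVec p (n + 1) ((a.1 + t) / 3)) ^ (-θ) ≤
        ∑ j, l j ^ (-θ) + ((l ᵥ* meanMatrix p a) ⬝ᵥ coverVec p n t) ^ (-θ) := by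
  rw [← dotProduct_mulVec] at h ⊢
  exact rpow_neg_dotProduct_le hθ0 hθ1 hl (mulVec_coverVec_nonneg p n a t) h
    (coverVec_succ_ge p n a t)

/-- Since `0 ^ (-θ) = 0` by convention for `θ ≠ 0`, a bounded negative moment is informative only
once the base is known to be positive. -/
theorem dotProduct_coverVec_pos (hp : 0 < (p : ℝ)) (n : ℕ) {l : Fin 3 → ℝ} (hl : ∀ j, 0 < l j)
    {t : ℝ} (ht : t ∈ Set.Ico (0 : ℝ) 1) : 0 < l ⬝ᵥ coverVec p n t := by
  induction n generalizing l t with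
  | zero =>
    simp only [dotProduct, coverVec_zero p ht, mul_one]
    exact Finset.sum_pos (fun j _ => hl j) Finset.univ_nonempty
  | succ n ih =>
    obtain ⟨a, u, hu, rfl⟩ := exists_ternary_digit ht
    -- Only the positivity half is used, so any exponent would do; here `θ = 1`.
    exact (dotProduct_coverVec_succ zero_le_one le_rfl hl a
      (ih (vecMul_meanMatrix_pos hp a hl) hu)).1

theorem lintegral_rpow_coverVec_le (hp : 0 < (p : ℝ)) (hθ0 : 0 ≤ θ) (hθ1 : θ ≤ 1) (n : ℕ)
    {l : Fin 3 → ℝ} (hl : ∀ j, 0 < l j) :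
    ∫⁻ t in Set.Ico (0 : ℝ) 1, ENNReal.ofReal ((l ⬝ᵥ coverVec p n t) ^ (-θ)) ≤
      ENNReal.ofReal (momentBound p θ n l) := by
  induction n generalizing l with
  | zero =>
    have hS : ∑ j, l j ≥ l 0 := Finset.single_le_sum (fun j _ => (hl j).le) (Finset.mem_univ 0)
    have hle (t : ℝ) (ht : t ∈ Set.Ico (0 : ℝ) 1) :
        ENNReal.ofReal ((l ⬝ᵥ coverVec p 0 t) ^ (-θ)) ≤ ENNReal.ofReal (momentBound p θ 0 l) := by
      refine ENNReal.ofReal_le_ofReal ?_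
      simp only [momentBound, zero_add, Finset.range_one, Finset.sum_singleton, avgPow,
        dotProduct_single, mul_one]
      simp only [dotProduct, coverVec_zero p ht, mul_one]
      exact (Real.rpow_le_rpow_of_nonpos (hl 0) hS (neg_nonpos.2 hθ0)).trans
        (Finset.single_le_sum (f := fun j => l j ^ (-θ))
          (fun j _ => Real.rpow_nonneg (hl j).le _) (Finset.mem_univ 0))
    refine (setLIntegral_mono' measurableSet_Ico hle).trans ?_
    simp
  | succ n ih =>
    have hL : 0 ≤ ∑ j, l j ^ (-θ) := Finset.sum_nonneg fun j _ => Real.rpow_nonneg (hl j).le _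
    have hl' (a : Fin 3) := vecMul_meanMatrix_pos hp a hl
    have hmeas (n : ℕ) (l : Fin 3 → ℝ) :
        Measurable fun t => ENNReal.ofReal ((l ⬝ᵥ coverVec p n t) ^ (-θ)) :=
      ((measurable_dotProduct_coverVec p n l).pow_const _).ennreal_ofReal
    have hstep (a : Fin 3) : ∫⁻ t in Set.Ico (0 : ℝ) 1,
        ENNReal.ofReal ((l ⬝ᵥ coverVec p (n + 1) ((a.1 + t) / 3)) ^ (-θ)) ≤
        ENNReal.ofReal (∑ j, l j ^ (-θ) + momentBound p θ n (l ᵥ* meanMatrix p a)) := by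
      calc _ ≤ ∫⁻ t in Set.Ico (0 : ℝ) 1, (ENNReal.ofReal (∑ j, l j ^ (-θ)) +
            ENNReal.ofReal (((l ᵥ* meanMatrix p a) ⬝ᵥ coverVec p n t) ^ (-θ))) := by
            refine setLIntegral_mono' measurableSet_Ico fun t ht => ?_
            have hpos := dotProduct_coverVec_pos hp n (hl' a) ht
            rw [← ENNReal.ofReal_add hL (Real.rpow_nonneg hpos.le _)]
            exact ENNReal.ofReal_le_ofReal (dotProduct_coverVec_succ hθ0 hθ1 hl a hpos).2
        _ ≤ _ := by
            rw [lintegral_add_left measurable_const, ENNReal.ofReal_add hL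
              (momentBound_nonneg hp n (hl' a))]
            refine add_le_add (by simp) (ih (hl' a))
    rw [setLIntegral_Ico_zero_one (hmeas (n + 1) l), momentBound_succ]
    calc _ ≤ ENNReal.ofReal (1 / 3) * ∑ a : Fin 3,
          ENNReal.ofReal (∑ j, l j ^ (-θ) + momentBound p θ n (l ᵥ* meanMatrix p a)) := by
          gcongr with a
          exact hstep a
      _ = _ := by
          rw [← ENNReal.ofReal_sum_of_nonneg fun a _ =>
            add_nonneg hL (momentBound_nonneg hp n (hl' a)),
            ← ENNReal.ofReal_mul (by norm_num), Finset.sum_add_distrib]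
          congr 1
          simp only [Finset.sum_const, Finset.card_univ, Fintype.card_fin, nsmul_eq_mul]
          push_cast
          ring

/-! ### From negative moments to positive length -/

/-- A pointwise Markov inequality: `K = (2 * C) ^ (-θ⁻¹)` solves `K ^ (-θ) = 2 * C`, so for `x < K`
the last term alone is at least `K`. -/
theorem le_add_mul_rpow_neg {C x : ℝ} (hC : 0 < C) (hθ : 0 < θ) (hx : 0 < x) :
    (2 * C) ^ (-θ⁻¹) ≤ x + (2 * C) ^ (-θ⁻¹) / (2 * C) * x ^ (-θ) := by
  have hK : 0 < (2 * C) ^ (-θ⁻¹) := Real.rpow_pos_of_pos (by linarith) _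
  rcases le_or_gt ((2 * C) ^ (-θ⁻¹)) x with h | h
  · have : 0 ≤ (2 * C) ^ (-θ⁻¹) / (2 * C) * x ^ (-θ) := by positivity
    linarith
  · have h1 := Real.rpow_le_rpow_of_nonpos hx h.le (neg_nonpos.2 hθ.le)
    rw [← Real.rpow_mul (by linarith), neg_mul_neg, inv_mul_cancel₀ hθ.ne', Real.rpow_one] at h1
    have h2 := mul_le_mul_of_nonneg_left h1
      (div_nonneg hK.le (by linarith : 0 ≤ 2 * C))
    rw [div_mul_cancel₀ _ (by linarith)] at h2
    linarith

theorem exists_lintegral_coverVec_ge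
    (hp : (8 * 6 * 6 : ℝ) ^ (-(1 / 3 : ℝ)) < (p : ℝ)) :
    ∃ c : ℝ, 0 < c ∧ ∀ n, ENNReal.ofReal c ≤
      ∫⁻ t in Set.Ico (0 : ℝ) 1, ENNReal.ofReal (1 ⬝ᵥ coverVec p n t) := by
  have hp0 : 0 < (p : ℝ) := lt_trans (Real.rpow_pos_of_pos (by norm_num) _) hp
  obtain ⟨θ, hθ0, hθ1, hr⟩ := exists_rate_lt_one hp
  set C := 3 / (1 - rate p θ)
  have hC : 0 < C := div_pos (by norm_num) (by linarith)
  set K := (2 * C) ^ (-θ⁻¹) with hKdef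
  have hK : 0 < K := Real.rpow_pos_of_pos (by linarith) _
  refine ⟨K / 2, half_pos hK, fun n => ?_⟩
  have hone : ∀ j, 0 < (1 : Fin 3 → ℝ) j := fun _ => one_pos
  have hU := (lintegral_rpow_coverVec_le hp0 hθ0.le hθ1.le n hone).trans
    (ENNReal.ofReal_le_ofReal (momentBound_one_le hp0 hθ0.le hr n))
  have hint : ENNReal.ofReal K ≤
      ∫⁻ t in Set.Ico (0 : ℝ) 1, (ENNReal.ofReal (1 ⬝ᵥ coverVec p n t) +
        ENNReal.ofReal (K / (2 * C)) * ENNReal.ofReal ((1 ⬝ᵥ coverVec p n t) ^ (-θ))) := by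
    calc ENNReal.ofReal K = ∫⁻ _t in Set.Ico (0 : ℝ) 1, ENNReal.ofReal K := by simp
      _ ≤ _ := by
        refine setLIntegral_mono' measurableSet_Ico fun t ht => ?_
        have hpos := dotProduct_coverVec_pos hp0 n hone ht
        rw [← ENNReal.ofReal_mul (by positivity), ← ENNReal.ofReal_add hpos.le (by positivity)]
        exact ENNReal.ofReal_le_ofReal (le_add_mul_rpow_neg hC hθ0 hpos)
  rw [lintegral_add_left (measurable_dotProduct_coverVec p n 1).ennreal_ofReal,
    lintegral_const_mul _ ((measurable_dotProduct_coverVec p n 1).pow_const _).ennreal_ofReal]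
    at hint
  -- The factor `2` in `2 * C` makes the negative moment cost only half of `K`; the other half
  -- bounds the mean.
  have h2 : ENNReal.ofReal (K / (2 * C)) * ENNReal.ofReal C = ENNReal.ofReal (K / 2) := by
    rw [← ENNReal.ofReal_mul (by positivity)]
    congr 1
    field_simp
  have h3 := hint.trans (add_le_add_right (mul_le_mul_right hU _) _)
  rw [h2, ← add_halves K, ENNReal.ofReal_add (half_pos hK).le (half_pos hK).le, add_halves] at h3
  exact (ENNReal.add_le_add_iff_right ENNReal.ofReal_ne_top).1 h3

/-- By Tonelli the product measure is the expected length, and the three coordinates of `coverVec`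
together sweep out `[0, 3)`. -/
theorem measure_projLevel_ge (n : ℕ) :
    ∫⁻ t in Set.Ico (0 : ℝ) 1, ENNReal.ofReal (1 ⬝ᵥ coverVec p n t) ≤
      (coinLaw MengerIndex p).prod volume
        {z : Sample MengerIndex × ℝ | z.2 ∈ projLevel n z.1} := by
  rw [Measure.prod_apply_symm (measurableSet_prod_projLevel n)]
  refine le_trans (le_of_eq ?_) (setLIntegral_le_lintegral (Set.Ico 0 3) _)
  rw [setLIntegral_Ico_zero_three, ← lintegral_finsetSum]
  · refine lintegral_congr fun t => ?_
    rw [one_dotProduct, ENNReal.ofReal_sum_of_nonneg (f := coverVec p n t)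
      fun j _ => coverProb_nonneg p n _]
    refine Finset.sum_congr rfl fun j _ => ?_
    rw [coverVec, coverProb, ofReal_measureReal]
    rfl
  · intro j _
    exact (measurable_measure_prodMk_right (measurableSet_prod_projLevel n)).comp
      (measurable_const_add _)

/-- The expected length of the limit is the limit of the expected lengths, because the sets decrease
and start with finite measure; it is therefore positive. -/
theorem measureReal_volume_projLimit_lt_one
    (hp : (8 * 6 * 6 : ℝ) ^ (-(1 / 3 : ℝ)) < (p : ℝ)) :
    (coinLaw MengerIndex p).real {ω | volume (projLimit ω) = 0} < 1 := by
  obtain ⟨c, hc, hcle⟩ := exists_lintegral_coverVec_ge hp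
  have hanti : Antitone fun n => {z : Sample MengerIndex × ℝ | z.2 ∈ projLevel n z.1} :=
    fun m n h z hz => antitone_projLevel z.1 h hz
  have hfin : (coinLaw MengerIndex p).prod volume
      {z : Sample MengerIndex × ℝ | z.2 ∈ projLevel 0 z.1} ≠ ⊤ := by
    have : {z : Sample MengerIndex × ℝ | z.2 ∈ projLevel 0 z.1} =
        Set.univ ×ˢ Set.Icc (0 : ℝ) 3 := by
      ext z
      simp [projLevel]
    rw [this, Measure.prod_prod]
    simp
  have hlim := tendsto_measure_iInter_atTop
    (fun n => (measurableSet_prod_projLevel n).nullMeasurableSet) hanti ⟨0, hfin⟩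
  have hge := ge_of_tendsto' hlim fun n => (hcle n).trans (measure_projLevel_ge n)
  have heq : ⋂ n, {z : Sample MengerIndex × ℝ | z.2 ∈ projLevel n z.1} =
      {z | z.2 ∈ projLimit z.1} := by
    ext z
    simp [projLimit]
  rw [heq, Measure.prod_apply measurableSet_prod_projLimit] at hge
  refine lt_of_le_of_ne measureReal_le_one fun h1 => ?_
  have hae : ∀ᵐ ω ∂coinLaw MengerIndex p, volume (projLimit ω) = 0 := by
    rw [ae_iff, ← Set.compl_ofPred, ← measureReal_eq_zero_iff,
      probReal_compl_eq_one_sub measurableSet_volume_projLimit_eq_zero, h1, sub_self]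
  have h0 : ∫⁻ ω, volume (Prod.mk ω ⁻¹' {z : Sample MengerIndex × ℝ | z.2 ∈ projLimit z.1})
      ∂coinLaw MengerIndex p = 0 :=
    lintegral_eq_zero_of_ae_eq_zero hae
  rw [h0] at hge
  exact absurd hge (not_le.2 (ENNReal.ofReal_pos.2 hc))

end MengerPercolation

theorem theoremy54 (p : unitInterval) (hp : ((8 * 6 * 6 : ℝ) ^ (-(1 / 3 : ℝ))) < (p : ℝ)) :
    0 < MengerPercolation.coinLaw MengerPercolation.MengerIndex p
        (MengerPercolation.nonExtinction MengerPercolation.MengerIndex) ∧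
    ∀ᵐ ω ∂(ProbabilityTheory.cond
        (MengerPercolation.coinLaw MengerPercolation.MengerIndex p)
        (MengerPercolation.nonExtinction MengerPercolation.MengerIndex)),
      0 < MeasureTheory.volume
        (MengerPercolation.proj 1 1 1 '' MengerPercolation.randomMengerSponge ω) := by
  simp only [MengerPercolation.proj_image_randomMengerSponge]
  exact MengerPercolation.positive_of_not_ae_null p
    (lt_trans (Real.rpow_pos_of_pos (by norm_num) _) hp)
    (MengerPercolation.measureReal_volume_projLimit_lt_one hp)
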